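/- Let $K$ be an uncountable algebraically closed field of characteristic zero, let $n\ge 0$, and let $d=d/dt$ on $K[[t]]$. For $R\in\{K[[t]],K\}$ let $R\{x_1,\dots,x_n\}$ be the polynomial ring over $R$ in the variables $x_{ij}$ ($1\le i\le n$, $j\ge 0$); write $x^M=\prod_{i,j}x_{ij}^{M_{ij}}$ for $M=(M_{ij})$ with finitely many nonzero entries in $\mathbb Z_{\ge0}$. Extend $d$ to a derivation of $K[[t]]\{x_1,\dots,x_n\}$ by $d(x_{ij})=x_{i(j+1)}$, and let $I\subset K[[t]]\{x_1,\dots,x_n\}$ be a differential ideal, i.e. an ideal with $d(I)\subset I$. For $\varphi\in K[[t]]^n$, $P(\varphi)$ is obtained by evaluating $x_{ij}$ at $d^j\varphi_i$, and $\operatorname{Sol}(I)=\{\varphi\in K[[t]]^n : P(\varphi)=0 \text{ for all } P\in I\}$. Let $\operatorname{trop}(\varphi)=(\operatorname{supp}\varphi_1,\dots,\operatorname{supp}\varphi_n)\in\mathcal P(\mathbb Z_{\ge0})^n$, where $\operatorname{supp}$ denotes the set of exponents with nonzero coefficient, and $\operatorname{trop}(\operatorname{Sol}(I))=\{\operatorname{trop}(\varphi):\varphi\in\operatorname{Sol}(I)\}$.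 For $S\subset\mathbb Z_{\ge0}$ put $\operatorname{Val}_S(j)=\min\{s\in S: s\ge j\}-j$, or $\infty$ if there is no such $s$. For $P=\sum_{M\in\Lambda}\varphi_M x^M$ ($\Lambda$ finite, $\varphi_M\neq0$) and $S\in\mathcal P(\mathbb Z_{\ge0})^n$, let $\nu$ be the $t$-adic valuation and put $$\operatorname{trop}(P)(S)=\min_{M\in\Lambda}\Big(\nu(\varphi_M)+\sum_{i,j}M_{ij}\operatorname{Val}_{S_i}(j)\Big)\in\mathbb Z_{\ge0}\cup\{\infty\}$$ (with $0\cdot\infty=0$ and $\min\emptyset=\infty$). Then $S$ is a solution of $\operatorname{trop}(P)$ if $\operatorname{trop}(P)(S)=\infty$ or this minimum is attained for at least two different $M\in\Lambda$; $\operatorname{Sol}(\operatorname{trop}(I))$ is the set of $S$ that are solutions of $\operatorname{trop}(P)$ for all $P\in I$. The $S$-initial part $\operatorname{In}_S(P)\in K\{x_1,\dots,x_n\}$ is $0$ if $\operatorname{trop}(P)(S)=\infty$; otherwise it is the image, under reducing coefficients from $K[[t]]$ to the residue field $K$, of $$P_S=t^{-\operatorname{trop}(P)(S)}\,P\big(t^{\operatorname{Val}_{S_i}(j)}x_{ij}\big)_{i,j}\in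 K[[t]]\{x_1,\dots,x_n\}$$ (with $t^\infty=0$). The $S$-initial ideal $\operatorname{In}_S(I)$ is the ideal of $K\{x_1,\dots,x_n\}$ generated by all $\operatorname{In}_S(P)$ with $P\in I$. A monomial of $K\{x_1,\dots,x_n\}$ is an element $c\,x^M$ with $c\in K\setminus\{0\}$ (nonzero constants included). Then the following three subsets of $\mathcal P(\mathbb Z_{\ge0})^n$ coincide: 1. $\operatorname{trop}(\operatorname{Sol}(I))$, 2. $\operatorname{Sol}(\operatorname{trop}(I))$, 3. $\{S\in\mathcal P(\mathbb Z_{\ge0})^n : \operatorname{In}_S(I)\text{ contains no monomial}\}$. -/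

import Mathlib

open scoped PowerSeries

noncomputable section

namespace TropDiff

/-! ## Differential algebra -/

/-- The ring `R{x_1, …, x_n}` of differential polynomials: polynomials over `R` in the
variables `x_{ij}`, indexed by the pairs `(i, j)` with `i : Fin n` and `j : ℕ`. -/
abbrev DiffPoly (n : ℕ) (R : Type*) [CommSemiring R] : Type _ :=
  MvPolynomial (Fin n × ℕ) R

/-- An exponent matrix `M = (M_{ij})` with finitely many nonzero entries. -/
abbrev Expo (n : ℕ) : Type := (Fin n × ℕ) →₀ ℕ

section DifferentialAlgebra

variable {n : ℕ} {k R : Type*} [CommRing k] [CommRing R] [Algebra k R]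

/-- Apply a derivation of `R` to every coefficient of a differential polynomial. -/
def coeffwise (d : Derivation k R R) (P : DiffPoly n R) : DiffPoly n R :=
  ∑ M ∈ P.support, MvPolynomial.monomial M (d (P.coeff M))

theorem coeff_coeffwise (d : Derivation k R R) (P : DiffPoly n R) (M : Expo n) :
    (coeffwise d P).coeff M = d (P.coeff M) := by
  classical
  rw [coeffwise, MvPolynomial.coeff_sum]
  simp only [MvPolynomial.coeff_monomial]
  rw [Finset.sum_ite_eq']
  split_ifs with h
  · rfl
  · rw [MvPolynomial.notMem_support_iff.mp h, map_zero]

/-- The extension of a derivation `d` of `R` to `R{x_1, …, x_n}` with `d x_{ij} = x_{i(j+1)}`. -/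
def extend (d : Derivation k R R) (P : DiffPoly n R) : DiffPoly n R :=
  coeffwise d P +
    MvPolynomial.mkDerivation R
      (fun p : Fin n × ℕ => (MvPolynomial.X (p.1, p.2 + 1) : DiffPoly n R)) P

theorem extend_add (d : Derivation k R R) (P Q : DiffPoly n R) :
    extend d (P + Q) = extend d P + extend d Q := by
  have h : coeffwise d (P + Q) = coeffwise d P + coeffwise d Q := by
    ext M
    simp [coeff_coeffwise]
  rw [extend, h, map_add, extend, extend]
  ring

theorem extend_mul (d : Derivation k R R) (P Q : DiffPoly n R) :
    extend d (P * Q) = extend d P * Q + P * extend d Q := by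
  classical
  have h : coeffwise d (P * Q) = coeffwise d P * Q + P * coeffwise d Q := by
    ext M
    simp only [coeff_coeffwise, MvPolynomial.coeff_add, MvPolynomial.coeff_mul, map_sum,
      Derivation.leibniz, smul_eq_mul, ← Finset.sum_add_distrib]
    exact Finset.sum_congr rfl fun p _ => by ring
  rw [extend, h, Derivation.leibniz, extend, extend, smul_eq_mul, smul_eq_mul]
  ring

theorem extend_C (d : Derivation k R R) (a : R) :
    extend d (MvPolynomial.C a : DiffPoly n R) = MvPolynomial.C (d a) := by
  classical
  have h : coeffwise d (MvPolynomial.C a : DiffPoly n R) = MvPolynomial.C (d a) := by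
    ext M
    rw [coeff_coeffwise, MvPolynomial.coeff_C, MvPolynomial.coeff_C]
    split_ifs <;> simp
  rw [extend, h, MvPolynomial.derivation_C, add_zero]

theorem extend_X (d : Derivation k R R) (i : Fin n) (j : ℕ) :
    extend d (MvPolynomial.X (i, j) : DiffPoly n R) = MvPolynomial.X (i, j + 1) := by
  classical
  have h : coeffwise d (MvPolynomial.X (i, j) : DiffPoly n R) = 0 := by
    ext M
    rw [coeff_coeffwise, MvPolynomial.coeff_X]
    split_ifs <;> simp
  rw [extend, h, MvPolynomial.mkDerivation_X, zero_add]

/-- `I ⊆ R{x_1, …, x_n}` is a differential ideal: an ideal stable under the derivation. -/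
def IsDifferentialIdeal (d : Derivation k R R) (I : Ideal (DiffPoly n R)) : Prop :=
  ∀ P ∈ I, extend d P ∈ I

/-- The value `P(φ)`: each variable `x_{ij}` is evaluated at `d^j φ_i`. -/
def evalAt (d : Derivation k R R) (φ : Fin n → R) (P : DiffPoly n R) : R :=
  MvPolynomial.eval (fun p : Fin n × ℕ => (⇑d)^[p.2] (φ p.1)) P

/-- `Sol(A)`, the set of common solutions in `R^n` of a set of differential polynomials. -/
def Sol (d : Derivation k R R) (A : Set (DiffPoly n R)) : Set (Fin n → R) :=
  {φ | ∀ P ∈ A, evalAt d φ P = 0}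

end DifferentialAlgebra

/-! ## The power series ring -/

section PowerSeriesRing

variable {n : ℕ} (K : Type*) [Field K]

/-- The derivation `d/dt` of `K[[t]]`. -/
def ddt : Derivation K K⟦X⟧ K⟦X⟧ :=
  PowerSeries.derivative K

variable {K}

/-- The support of a power series. -/
def supp (φ : K⟦X⟧) : Set ℕ := {i | PowerSeries.coeff i φ ≠ 0}

/-- The tropicalisation of an `n`-tuple of power series: the tuple of the supports. -/
def tropTuple (φ : Fin n → K⟦X⟧) : Fin n → Set ℕ := fun i => supp (φ i)

end PowerSeriesRing

/-! ## Tropical differential algebra -/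

open Classical in
/-- `Val_S(j) = min {s ∈ S : s ≥ j} - j`, and `∞` if no element of `S` is at least `j`. -/
def Val (S : Set ℕ) (j : ℕ) : ℕ∞ :=
  if ∃ s ∈ S, j ≤ s then ((sInf {s | s ∈ S ∧ j ≤ s} - j : ℕ) : ℕ∞) else ⊤

/-- Tropical differential polynomials: polynomials in the `x_{ij}` over the semiring
`(ℤ_{≥0} ∪ {∞}, min, +)`. The monomials with coefficient `∞`, the zero of the semiring, are
not in the support; they do not affect evaluation or the notion of a solution. -/
abbrev TropDiffPoly (n : ℕ) : Type := DiffPoly n (Tropical ℕ∞)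

section TropicalAlgebra

variable {n : ℕ}

/-- `∑ M_{ij} Val_{S_i}(j)`, with `0 · ∞ = 0`. -/
def weight (S : Fin n → Set ℕ) (M : Expo n) : ℕ∞ :=
  M.sum fun p k => k • Val (S p.1) p.2

/-- The value at `S` of the term of `f` with exponent `M`. -/
def termValue (f : TropDiffPoly n) (S : Fin n → Set ℕ) (M : Expo n) : ℕ∞ :=
  Tropical.untrop (f.coeff M) + weight S M

/-- The value `f(S)`, the minimum of the values of the terms (`∞` if there are none). -/
def tropEval (f : TropDiffPoly n) (S : Fin n → Set ℕ) : ℕ∞ :=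
  f.support.inf (termValue f S)

/-- `S` is a solution of `f`: the minimum is attained at two different terms, or is `∞`. -/
def IsTropSolution (f : TropDiffPoly n) (S : Fin n → Set ℕ) : Prop :=
  (∃ M₁ ∈ f.support, ∃ M₂ ∈ f.support, M₁ ≠ M₂ ∧
    tropEval f S = termValue f S M₁ ∧ tropEval f S = termValue f S M₂) ∨
  tropEval f S = ⊤

/-- `Sol(A)`, the set of common solutions of a set of tropical differential polynomials. -/
def TropSol (A : Set (TropDiffPoly n)) : Set (Fin n → Set ℕ) :=
  {S | ∀ f ∈ A, IsTropSolution f S}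

end TropicalAlgebra

/-! ## Tropicalisation and initial parts -/

section InitialParts

variable {n : ℕ} {K : Type*} [Field K]

/-- The tropicalisation of a differential polynomial: each coefficient is replaced by its
`t`-adic valuation. -/
def tropPoly (P : DiffPoly n K⟦X⟧) : TropDiffPoly n :=
  ∑ M ∈ P.support, MvPolynomial.monomial M (Tropical.trop (P.coeff M).order)

/-- `t ^ v` for `v ∈ ℤ_{≥0} ∪ {∞}`, with `t ^ ∞ = 0`. -/
def tPow (v : ℕ∞) : K⟦X⟧ :=
  if v = ⊤ then 0 else PowerSeries.X ^ v.toNat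

/-- The differential polynomial obtained from `P` by the substitution
`x_{ij} ↦ t^{Val_{S_i}(j)} x_{ij}`. -/
def rescale (S : Fin n → Set ℕ) (P : DiffPoly n K⟦X⟧) : DiffPoly n K⟦X⟧ :=
  MvPolynomial.bind₁
    (fun p : Fin n × ℕ => MvPolynomial.C (tPow (Val (S p.1) p.2)) * MvPolynomial.X p) P

/-- Division of a power series by `t ^ v`; it is exact on the series of valuation `≥ v`. -/
def divT (v : ℕ) (ψ : K⟦X⟧) : K⟦X⟧ :=
  PowerSeries.mk fun k => PowerSeries.coeff (k + v) ψ

/-- `P_S = t^{-trop(P)(S)} P(t^{Val_{S_i}(j)} x_{ij})` if `trop(P)(S) ≠ ∞`, and `0` otherwise.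
The division by the power of `t` is exact, as proved in `C_mul_normalised`. -/
def normalised (S : Fin n → Set ℕ) (P : DiffPoly n K⟦X⟧) : DiffPoly n K⟦X⟧ :=
  if tropEval (tropPoly P) S = ⊤ then 0
  else ∑ M ∈ (rescale S P).support, MvPolynomial.monomial M
    (divT (tropEval (tropPoly P) S).toNat ((rescale S P).coeff M))

/-- The `S`-initial part of `P`: the reduction of `P_S` to the residue field `K`. -/
def initialPart (S : Fin n → Set ℕ) (P : DiffPoly n K⟦X⟧) : DiffPoly n K :=
  MvPolynomial.map (PowerSeries.constantCoeff (R := K)) (normalised S P)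

/-- The `S`-initial ideal of `I`, generated by the `S`-initial parts of its elements. -/
def initialIdeal (S : Fin n → Set ℕ) (I : Ideal (DiffPoly n K⟦X⟧)) : Ideal (DiffPoly n K) :=
  Ideal.span (initialPart S '' (I : Set (DiffPoly n K⟦X⟧)))

/-- The ideal `J` contains a monomial `c x^M`, `c ≠ 0` (`x^M = 1` is allowed). -/
def ContainsMonomial (J : Ideal (DiffPoly n K)) : Prop :=
  ∃ (M : Expo n) (c : K), c ≠ 0 ∧ MvPolynomial.monomial M c ∈ J

theorem coeff_tropPoly (P : DiffPoly n K⟦X⟧) (M : Expo n) :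
    (tropPoly P).coeff M = Tropical.trop (P.coeff M).order := by
  classical
  rw [tropPoly, MvPolynomial.coeff_sum]
  simp only [MvPolynomial.coeff_monomial]
  rw [Finset.sum_ite_eq']
  split_ifs with h
  · rfl
  · rw [MvPolynomial.notMem_support_iff.mp h, PowerSeries.order_zero]
    rfl

theorem tPow_zero : tPow (K := K) 0 = 1 := by
  simp [tPow]

theorem tPow_add (a b : ℕ∞) : tPow (K := K) (a + b) = tPow a * tPow b := by
  unfold tPow
  by_cases ha : a = ⊤
  · simp [ha]
  by_cases hb : b = ⊤
  · simp [hb]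
  rw [if_neg (by simp [ha, hb]), if_neg ha, if_neg hb, ENat.toNat_add ha hb, pow_add]

theorem tPow_nsmul (k : ℕ) (a : ℕ∞) : tPow (K := K) (k • a) = tPow a ^ k := by
  induction k with
  | zero => rw [zero_smul, tPow_zero, pow_zero]
  | succ k ih => rw [succ_nsmul, tPow_add, ih, pow_succ]

theorem tPow_weight (S : Fin n → Set ℕ) (M : Expo n) :
    tPow (K := K) (weight S M) = M.prod fun p k => tPow (Val (S p.1) p.2) ^ k := by
  classical
  rw [weight, Finsupp.sum, Finsupp.prod]
  induction M.support using Finset.induction_on with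
  | empty => simp [tPow_zero]
  | insert p s hp ih => rw [Finset.sum_insert hp, Finset.prod_insert hp, tPow_add, ih, tPow_nsmul]

theorem coeff_rescale (S : Fin n → Set ℕ) (P : DiffPoly n K⟦X⟧) (M : Expo n) :
    (rescale S P).coeff M = P.coeff M * tPow (weight S M) := by
  classical
  induction P using MvPolynomial.induction_on' with
  | monomial N a =>
    have h : rescale S (MvPolynomial.monomial N a) =
        MvPolynomial.monomial N (a * tPow (weight S N)) := by
      rw [rescale, MvPolynomial.bind₁_monomial, MvPolynomial.monomial_eq, map_mul, tPow_weight]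
      simp only [mul_pow, Finset.prod_mul_distrib, Finsupp.prod, map_prod, map_pow, mul_assoc]
    rw [h, MvPolynomial.coeff_monomial, MvPolynomial.coeff_monomial]
    split_ifs with e
    · rw [e]
    · rw [zero_mul]
  | add p q hp hq =>
    have h : rescale S (p + q) = rescale S p + rescale S q := by simp [rescale]
    rw [h, MvPolynomial.coeff_add, MvPolynomial.coeff_add, hp, hq, add_mul]

theorem X_pow_mul_divT {v : ℕ} {ψ : K⟦X⟧} (h : (v : ℕ∞) ≤ ψ.order) :
    PowerSeries.X ^ v * divT v ψ = ψ := by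
  ext k
  rw [PowerSeries.coeff_X_pow_mul']
  split_ifs with hk
  · rw [divT, PowerSeries.coeff_mk, Nat.sub_add_cancel hk]
  · refine (PowerSeries.coeff_of_lt_order k (lt_of_lt_of_le ?_ h)).symm
    exact_mod_cast not_le.mp hk

theorem tropEval_le_order (S : Fin n → Set ℕ) (P : DiffPoly n K⟦X⟧) (M : Expo n) :
    tropEval (tropPoly P) S ≤ ((rescale S P).coeff M).order := by
  have h1 : tropEval (tropPoly P) S ≤ termValue (tropPoly P) S M := by
    by_cases hM : M ∈ (tropPoly P).support
    · exact Finset.inf_le hM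
    · rw [termValue, MvPolynomial.notMem_support_iff.mp hM]
      simp
  refine h1.trans ?_
  rw [termValue, coeff_tropPoly, Tropical.untrop_trop, coeff_rescale, PowerSeries.order_mul]
  gcongr
  unfold tPow
  split_ifs with hw
  · simp
  · rw [PowerSeries.order_X_pow, ENat.natCast_toNat hw]

/-- The division in the definition of `P_S` is exact. -/
theorem C_mul_normalised (S : Fin n → Set ℕ) (P : DiffPoly n K⟦X⟧)
    (h : tropEval (tropPoly P) S ≠ ⊤) :
    MvPolynomial.C (tPow (tropEval (tropPoly P) S)) * normalised S P = rescale S P := by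
  classical
  ext1 M
  rw [MvPolynomial.coeff_C_mul, normalised, if_neg h, MvPolynomial.coeff_sum]
  simp only [MvPolynomial.coeff_monomial]
  rw [Finset.sum_ite_eq', tPow, if_neg h]
  split_ifs with hM
  · apply X_pow_mul_divT
    rw [ENat.natCast_toNat h]
    exact tropEval_le_order S P M
  · rw [mul_zero, MvPolynomial.notMem_support_iff.mp hM]

end InitialParts

end TropDiff

end

/-!
Three inclusions between the set `trop(Sol(I))`, the set `Sol(trop(I))` and the set of the `S` such
that `In_S(I)` contains no monomial close up to a cycle.

* `not_containsMonomial_of_mem_Sol`: for a solution `φ` with support tuple `S` one has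
  `d^j φ_i = t^{Val_{S_i}(j)} u_{ij}` with `u_{ij}` a unit. For `P ∈ I` the vanishing of `P(φ)`
  says that `P_S` vanishes at `u`, so `In_S(P)`, and with it all of `In_S(I)`, vanishes at the
  constant coefficients of the `u_{ij}`. These are all nonzero, so no monomial vanishes there.
* `mem_TropSol_of_not_containsMonomial`: if the minimum `trop(P)(S)` is finite and attained only
  once, then `In_S(P)` is itself a monomial.
* `exists_mem_Sol_of_mem_TropSol`: since `K` has characteristic zero, a power series is determined
  by the values at `t = 0` of its derivatives, and these can be prescribed. As `I` is differential,
  `Sol(I)` becomes the zero locus of the reduction `I₀` of `I` modulo `t`, in a space with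
  countably many coordinates (`mem_Sol_iff`), and the support tuple is `S` exactly when the
  coordinates that vanish are those `(i, j)` with `j ∉ S_i`. Over an uncountable algebraically
  closed field the Nullstellensatz holds in countably many variables
  (`MvPolynomial.exists_zero_ne_zero_on`). So if there is no such point, then a monomial `x^M` in
  the `x_{ij}` with `j ∈ S_i` lies in `I₀ + (x_{ij} : j ∉ S_i)`. A lift `P ∈ I` of its component
  in `I₀` has `trop(P)(S) = 0`, attained at `M` only (`not_isTropSolution_of_map_eq`), so `S` is
  not a solution of `trop(I)`.
-/

/-! ### A Nullstellensatz in countably many variables -/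

section Nullstellensatz

/-- For a transcendental element `x` the uncountably many `(x - a)⁻¹`, `a ∈ K`, would be linearly
independent. So a field extension of countable dimension is algebraic. -/
theorem IsAlgClosed.nonempty_algHom_of_rank_le_aleph0 {K F : Type*} [Field K] [IsAlgClosed K]
    [Uncountable K] [Field F] [Algebra K F] (h : Module.rank K F ≤ Cardinal.aleph0) :
    Nonempty (F →ₐ[K] K) := by
  have halg : Algebra.IsAlgebraic K F := by
    refine ⟨fun x => ?_⟩
    by_contra hx
    have hlin := (Transcendental.linearIndependent_sub_inv (F := K) hx).cardinal_lift_le_rank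
    have h2 := hlin.trans (Cardinal.lift_le.2 h)
    rw [Cardinal.lift_aleph0, Cardinal.lift_le_aleph0] at h2
    exact absurd h2 (not_le.2 Cardinal.aleph0_lt_mk)
  exact ⟨IsAlgClosed.lift⟩

variable {σ K : Type*} [Countable σ] [Field K] [IsAlgClosed K] [Uncountable K]

theorem MvPolynomial.exists_zero_of_ne_top_of_countable (J : Ideal (MvPolynomial σ K))
    (hJ : J ≠ ⊤) : ∃ a : σ → K, ∀ p ∈ J, MvPolynomial.eval a p = 0 := by
  obtain ⟨m, hm, hJm⟩ := Ideal.exists_le_maximal J hJ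
  have hrank : Module.rank K (MvPolynomial σ K ⧸ m) ≤ Cardinal.aleph0 := by
    have h1 := (Ideal.Quotient.mkₐ K m).toLinearMap.lift_rank_le_of_surjective
      (Ideal.Quotient.mkₐ_surjective K m)
    rw [Cardinal.lift_id, Cardinal.lift_id] at h1
    refine h1.trans ?_
    rw [← Cardinal.lift_le_aleph0, ← (MvPolynomial.basisMonomials σ K).mk_eq_rank,
      Cardinal.lift_le_aleph0]
    exact Cardinal.mk_le_aleph0
  let := Ideal.Quotient.field m
  obtain ⟨g⟩ := IsAlgClosed.nonempty_algHom_of_rank_le_aleph0 hrank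
  let f : MvPolynomial σ K →ₐ[K] K := g.comp (Ideal.Quotient.mkₐ K m)
  refine ⟨fun i => f (MvPolynomial.X i), fun p hp => ?_⟩
  have hf : f p = 0 := by
    have : Ideal.Quotient.mkₐ K m p = 0 := by
      simpa using Ideal.Quotient.eq_zero_iff_mem.2 (hJm hp)
    simp only [f, AlgHom.comp_apply, this, map_zero]
  rw [← hf, ← MvPolynomial.coe_aeval_eq_eval, RingHom.coe_coe]
  exact (DFunLike.congr_fun (MvPolynomial.aeval_unique f) p).symm

/-- The proof is Rabinowitsch's trick, with one extra variable `y_p` for every `p ∈ T`, subject to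
`x_p y_p = 1`; the other `y_p` play no role. -/
theorem MvPolynomial.exists_zero_ne_zero_on_of_isUnit {A : Type*} [CommRing A] [Nontrivial A]
    [Algebra K A] (ι : MvPolynomial σ K →ₐ[K] A) (T : Set σ)
    (hι : ∀ p ∈ T, IsUnit (ι (MvPolynomial.X p))) :
    ∃ a : σ → K, (∀ p, ι p = 0 → MvPolynomial.eval a p = 0) ∧ ∀ p ∈ T, a p ≠ 0 := by
  have hunit : ∀ p ∈ T, ∃ y, ι (MvPolynomial.X p) * y = 1 :=
    fun p hp => (hι p hp).exists_right_inv
  choose! y hy using hunit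
  let Φ : MvPolynomial (σ ⊕ σ) K →ₐ[K] A :=
    MvPolynomial.aeval (Sum.elim (fun p => ι (MvPolynomial.X p)) y)
  obtain ⟨a, ha⟩ := MvPolynomial.exists_zero_of_ne_top_of_countable _ (RingHom.ker_ne_top Φ)
  refine ⟨fun p => a (Sum.inl p), fun p hp => ?_, fun p hp h0 => ?_⟩
  · have h1 : Φ (MvPolynomial.rename Sum.inl p) = ι p := by
      rw [MvPolynomial.aeval_rename]
      exact (DFunLike.congr_fun (MvPolynomial.aeval_unique ι) p).symm
    have h3 := ha _ (show MvPolynomial.rename Sum.inl p ∈ RingHom.ker Φ from h1.trans hp)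
    rwa [MvPolynomial.eval_rename] at h3
  · have h1 : (MvPolynomial.X (Sum.inl p) * MvPolynomial.X (Sum.inr p) - 1 :
        MvPolynomial (σ ⊕ σ) K) ∈ RingHom.ker Φ := by
      simp [RingHom.mem_ker, Φ, hy p hp]
    have h2 := ha _ h1
    simp [h0] at h2

/-- The submonoid of monomials in the variables from `T`. -/
def MvPolynomial.monomialSubmonoid {σ : Type*} (K : Type*) [CommSemiring K] (T : Set σ) :
    Submonoid (MvPolynomial σ K) where
  carrier := {z | ∃ M : σ →₀ ℕ, (M.support : Set σ) ⊆ T ∧ MvPolynomial.monomial M 1 = z}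
  one_mem' := ⟨0, by simp, rfl⟩
  mul_mem' := by
    classical
    rintro _ _ ⟨M, hM, rfl⟩ ⟨M', hM', rfl⟩
    refine ⟨M + M', fun p hp => ?_, by rw [MvPolynomial.monomial_mul, one_mul]⟩
    rcases Finset.mem_union.1 (Finsupp.support_add hp) with h | h
    · exact hM h
    · exact hM' h

/-- If `J` contains no monomial in the variables from `T`, it has a zero at which none of these
variables vanishes: the localization of `K[x]/J` at these variables is nontrivial. -/
theorem MvPolynomial.exists_zero_ne_zero_on (J : Ideal (MvPolynomial σ K)) (T : Set σ)
    (hJ : ∀ M : σ →₀ ℕ, (M.support : Set σ) ⊆ T → MvPolynomial.monomial M (1 : K) ∉ J) :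
    ∃ a : σ → K, (∀ p ∈ J, MvPolynomial.eval a p = 0) ∧ ∀ p ∈ T, a p ≠ 0 := by
  let N := (MvPolynomial.monomialSubmonoid K T).map (Ideal.Quotient.mkₐ K J)
  have hnt : Nontrivial (Localization N) := by
    rw [← not_subsingleton_iff_nontrivial,
      IsLocalization.subsingleton_iff (S := Localization N) (M := N)]
    rintro ⟨_, ⟨M, hM, rfl⟩, h0⟩
    exact hJ M hM (Ideal.Quotient.eq_zero_iff_mem.1 h0)
  let ι : MvPolynomial σ K →ₐ[K] Localization N :=
    (IsScalarTower.toAlgHom K (MvPolynomial σ K ⧸ J) (Localization N)).comp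
      (Ideal.Quotient.mkₐ K J)
  obtain ⟨a, ha, ha0⟩ := MvPolynomial.exists_zero_ne_zero_on_of_isUnit (A := Localization N) ι T fun p hp => by
    have hmem : Ideal.Quotient.mkₐ K J (MvPolynomial.X p) ∈ N :=
      ⟨_, ⟨Finsupp.single p 1, fun q hq => by
        rw [Finset.mem_singleton.1 (Finsupp.support_single_subset hq)]; exact hp, rfl⟩, rfl⟩
    exact IsLocalization.map_units (Localization N) ⟨_, hmem⟩
  refine ⟨a, fun p hp => ha p ?_, ha0⟩
  have : Ideal.Quotient.mkₐ K J p = 0 := Ideal.Quotient.eq_zero_iff_mem.2 hp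
  simp only [ι, AlgHom.comp_apply, this, map_zero]

end Nullstellensatz

namespace TropDiff

open PowerSeries (constantCoeff coeff)

/-! ### Evaluation of differential polynomials -/

section Evaluation

variable {n : ℕ} {k R : Type*} [CommRing k] [CommRing R] [Algebra k R]

theorem evalAt_extend (d : Derivation k R R) (φ : Fin n → R) (P : DiffPoly n R) :
    evalAt d φ (extend d P) = d (evalAt d φ P) := by
  unfold evalAt
  induction P using MvPolynomial.induction_on with
  | C a => simp [extend_C]
  | add p q hp hq => rw [extend_add, map_add, map_add, map_add, hp, hq]
  | mul_X p i hp =>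
    obtain ⟨i, j⟩ := i
    rw [extend_mul, extend_X, map_add, map_mul, map_mul, map_mul, hp, Derivation.leibniz]
    simp only [MvPolynomial.eval_X, smul_eq_mul, Function.iterate_succ_apply']
    ring

theorem evalAt_iterate_extend (d : Derivation k R R) (φ : Fin n → R) (m : ℕ)
    (P : DiffPoly n R) : evalAt d φ ((extend d)^[m] P) = d^[m] (evalAt d φ P) := by
  induction m with
  | zero => rfl
  | succ m ih => rw [Function.iterate_succ_apply', evalAt_extend, ih, Function.iterate_succ_apply']

theorem IsDifferentialIdeal.iterate_mem {d : Derivation k R R} {I : Ideal (DiffPoly n R)}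
    (hI : IsDifferentialIdeal d I) {P : DiffPoly n R} (hP : P ∈ I) (m : ℕ) :
    (extend d)^[m] P ∈ I := by
  induction m with
  | zero => exact hP
  | succ m ih => rw [Function.iterate_succ_apply']; exact hI _ ih

end Evaluation

section PowerSeries

variable {n : ℕ} {K : Type*} [Field K]

theorem constantCoeff_eval (u : Fin n × ℕ → K⟦X⟧) (P : DiffPoly n K⟦X⟧) :
    constantCoeff (MvPolynomial.eval u P) =
      MvPolynomial.eval (fun p => constantCoeff (u p))
        (MvPolynomial.map (constantCoeff (R := K)) P) := by
  rw [MvPolynomial.eval_map]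
  exact MvPolynomial.eval₂_comp_left _ _ _ _

theorem coeff_iterate_ddt (ψ : K⟦X⟧) (j m : ℕ) :
    coeff m ((ddt K)^[j] ψ) = (m + 1).ascFactorial j • coeff (m + j) ψ :=
  (PowerSeries.coeff_iterate_derivative ψ j m).trans (nsmul_eq_mul _ _).symm

variable [CharZero K]

theorem coeff_iterate_ddt_ne_zero {ψ : K⟦X⟧} {j m : ℕ} :
    coeff m ((ddt K)^[j] ψ) ≠ 0 ↔ m + j ∈ supp ψ := by
  rw [coeff_iterate_ddt, nsmul_eq_mul, mul_ne_zero_iff]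
  simp [supp, (Nat.ascFactorial_pos m j).ne']

theorem eq_zero_of_constantCoeff_iterate_ddt {ψ : K⟦X⟧}
    (h : ∀ m, constantCoeff ((ddt K)^[m] ψ) = 0) : ψ = 0 := by
  ext m
  by_contra hm
  refine (coeff_iterate_ddt_ne_zero (ψ := ψ) (j := m) (m := 0)).2 ?_ ?_
  · rw [zero_add]; exact hm
  · rw [PowerSeries.coeff_zero_eq_constantCoeff_apply]; exact h m

/-! ### Power series solutions as points of the reduction at `t = 0` -/

/-- By Taylor's formula, a solution of a differential ideal is the same thing as a common zero,
given by the values at `t = 0` of its derivatives, of the reductions modulo `t`. -/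
theorem mem_Sol_iff {I : Ideal (DiffPoly n K⟦X⟧)} (hI : IsDifferentialIdeal (ddt K) I)
    (φ : Fin n → K⟦X⟧) :
    φ ∈ Sol (ddt K) (I : Set (DiffPoly n K⟦X⟧)) ↔ ∀ P ∈ I,
      MvPolynomial.eval (fun p => constantCoeff ((ddt K)^[p.2] (φ p.1)))
        (MvPolynomial.map (constantCoeff (R := K)) P) = 0 := by
  constructor
  · intro h P hP
    rw [← constantCoeff_eval (fun p => (ddt K)^[p.2] (φ p.1))]
    exact (congrArg constantCoeff (h P hP)).trans (map_zero _)
  · intro h P hP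
    refine eq_zero_of_constantCoeff_iterate_ddt fun m => ?_
    rw [← evalAt_iterate_extend, evalAt, constantCoeff_eval]
    exact h _ (hI.iterate_mem hP m)

theorem exists_constantCoeff_iterate_ddt (a : Fin n × ℕ → K) :
    ∃ φ : Fin n → K⟦X⟧, ∀ p : Fin n × ℕ, constantCoeff ((ddt K)^[p.2] (φ p.1)) = a p := by
  refine ⟨fun i => PowerSeries.mk fun j => a (i, j) / (j.factorial : K), fun p => ?_⟩
  have h : (p.2.factorial : K) ≠ 0 := by exact_mod_cast p.2.factorial_ne_zero
  rw [← PowerSeries.coeff_zero_eq_constantCoeff_apply, coeff_iterate_ddt]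
  simp only [zero_add, PowerSeries.coeff_mk, Nat.one_ascFactorial, nsmul_eq_mul]
  field_simp

/-! ### Valuations of terms -/

theorem Val_eq_zero_iff {S : Set ℕ} {j : ℕ} : Val S j = 0 ↔ j ∈ S := by
  unfold Val
  constructor
  · intro h
    split_ifs at h with hs
    · obtain ⟨s, hs, hjs⟩ := hs
      have hmem := Nat.sInf_mem (s := {s | s ∈ S ∧ j ≤ s}) ⟨s, hs, hjs⟩
      have h0 : sInf {s | s ∈ S ∧ j ≤ s} - j = 0 := by exact_mod_cast h
      have : sInf {s | s ∈ S ∧ j ≤ s} = j := le_antisymm (by omega) hmem.2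
      rw [this] at hmem
      exact hmem.1
    · exact absurd h (by simp)
  · intro h
    rw [if_pos ⟨j, h, le_rfl⟩]
    have : sInf {s | s ∈ S ∧ j ≤ s} ≤ j := Nat.sInf_le ⟨h, le_rfl⟩
    simp [Nat.sub_eq_zero_of_le this]

/-- The `j`-th derivative of `ψ` is `t ^ Val(j)` times a unit; when it vanishes, so that
`t ^ Val(j) = 0`, any unit will do. -/
theorem exists_iterate_ddt_eq (ψ : K⟦X⟧) (j : ℕ) :
    ∃ u : K⟦X⟧, (ddt K)^[j] ψ = tPow (Val (supp ψ) j) * u ∧ constantCoeff u ≠ 0 := by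
  by_cases hs : ∃ s ∈ supp ψ, j ≤ s
  · have hmem := Nat.sInf_mem (s := {s | s ∈ supp ψ ∧ j ≤ s}) hs
    set v := sInf {s | s ∈ supp ψ ∧ j ≤ s} with hv
    have hval : Val (supp ψ) j = ((v - j : ℕ) : ℕ∞) := by rw [Val, if_pos hs]
    refine ⟨divT (v - j) ((ddt K)^[j] ψ), ?_, ?_⟩
    · rw [hval, tPow, if_neg (ENat.natCast_ne_top _), ENat.toNat_natCast, X_pow_mul_divT]
      refine PowerSeries.nat_le_order _ _ fun i hi => ?_
      by_contra hne
      have h1 := coeff_iterate_ddt_ne_zero.1 hne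
      have h2 : v ≤ i + j := Nat.sInf_le ⟨h1, Nat.le_add_left _ _⟩
      omega
    · rw [← PowerSeries.coeff_zero_eq_constantCoeff_apply, divT, PowerSeries.coeff_mk, zero_add]
      rw [coeff_iterate_ddt_ne_zero, Nat.sub_add_cancel hmem.2]
      exact hmem.1
  · refine ⟨1, ?_, by simp⟩
    rw [Val, if_neg hs, tPow, if_pos rfl, zero_mul]
    ext m
    by_contra hne
    exact hs ⟨m + j, coeff_iterate_ddt_ne_zero.1 hne, Nat.le_add_left _ _⟩

end PowerSeries

section InitialParts

variable {n : ℕ} {K : Type*} [Field K]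

theorem mem_support_tropPoly {P : DiffPoly n K⟦X⟧} {M : Expo n} :
    M ∈ (tropPoly P).support ↔ M ∈ P.support := by
  rw [MvPolynomial.mem_support_iff, MvPolynomial.mem_support_iff, coeff_tropPoly, not_iff_not,
    ← PowerSeries.order_eq_top]
  exact Tropical.trop_injective.eq_iff' rfl

theorem order_tPow (v : ℕ∞) : (tPow v : K⟦X⟧).order = v := by
  unfold tPow
  split_ifs with hv
  · simp [hv]
  · rw [PowerSeries.order_X_pow, ENat.natCast_toNat hv]

theorem order_coeff_rescale (S : Fin n → Set ℕ) (P : DiffPoly n K⟦X⟧) (M : Expo n) :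
    ((rescale S P).coeff M).order = termValue (tropPoly P) S M := by
  rw [coeff_rescale, PowerSeries.order_mul, order_tPow, termValue, coeff_tropPoly,
    Tropical.untrop_trop]

theorem eval_rescale (S : Fin n → Set ℕ) (P : DiffPoly n K⟦X⟧) (u : Fin n × ℕ → K⟦X⟧) :
    MvPolynomial.eval u (rescale S P) =
      MvPolynomial.eval (fun p => tPow (Val (S p.1) p.2) * u p) P := by
  rw [rescale, ← MvPolynomial.coe_aeval_eq_eval, RingHom.coe_coe, MvPolynomial.aeval_bind₁,
    ← MvPolynomial.coe_aeval_eq_eval, RingHom.coe_coe]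
  simp

/-! ### Initial parts -/

theorem coeff_initialPart {S : Fin n → Set ℕ} {P : DiffPoly n K⟦X⟧}
    (h : tropEval (tropPoly P) S ≠ ⊤) (M : Expo n) :
    (initialPart S P).coeff M =
      coeff (tropEval (tropPoly P) S).toNat ((rescale S P).coeff M) := by
  classical
  rw [initialPart, MvPolynomial.coeff_map, normalised, if_neg h, MvPolynomial.coeff_sum]
  simp only [MvPolynomial.coeff_monomial]
  rw [Finset.sum_ite_eq']
  split_ifs with hM
  · rw [← PowerSeries.coeff_zero_eq_constantCoeff_apply, divT, PowerSeries.coeff_mk, zero_add]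
  · rw [MvPolynomial.notMem_support_iff.mp hM, map_zero, map_zero]

/-- If the minimum defining `trop(P)(S)` is finite and attained only once, then `In_S(P)` is a
monomial. -/
theorem exists_initialPart_eq_monomial {S : Fin n → Set ℕ} {P : DiffPoly n K⟦X⟧}
    (h : ¬ IsTropSolution (tropPoly P) S) :
    ∃ (M : Expo n) (c : K), c ≠ 0 ∧ initialPart S P = MvPolynomial.monomial M c := by
  classical
  rw [IsTropSolution, not_or] at h
  obtain ⟨h1, htop⟩ := h
  have hne : (tropPoly P).support.Nonempty := by
    by_contra he
    rw [Finset.not_nonempty_iff_eq_empty] at he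
    exact htop (by rw [tropEval, he, Finset.inf_empty])
  obtain ⟨M, hM, hMv⟩ := Finset.exists_mem_eq_inf _ hne (termValue (tropPoly P) S)
  change tropEval (tropPoly P) S = _ at hMv
  have hcoe := ENat.natCast_toNat htop
  refine ⟨M, (initialPart S P).coeff M, ?_, ?_⟩
  · rw [coeff_initialPart htop]
    refine (PowerSeries.order_eq_nat.1 ?_).1
    rw [order_coeff_rescale, hcoe, hMv]
  · ext M'
    rw [MvPolynomial.coeff_monomial]
    split_ifs with hMM'
    · rw [hMM']
    · rw [coeff_initialPart htop]
      by_cases hM' : M' ∈ (tropPoly P).support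
      · refine PowerSeries.coeff_of_lt_order _ ?_
        rw [order_coeff_rescale, hcoe]
        exact lt_of_le_of_ne (Finset.inf_le hM')
          fun he => h1 ⟨M, hM, M', hM', hMM', hMv, he⟩
      · rw [mem_support_tropPoly, MvPolynomial.notMem_support_iff] at hM'
        rw [coeff_rescale, hM', zero_mul, map_zero]

theorem mem_TropSol_of_not_containsMonomial {I : Ideal (DiffPoly n K⟦X⟧)} {S : Fin n → Set ℕ}
    (h : ¬ ContainsMonomial (initialIdeal S I)) :
    S ∈ TropSol (tropPoly '' (I : Set (DiffPoly n K⟦X⟧))) := by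
  rintro _ ⟨P, hP, rfl⟩
  by_contra hS
  obtain ⟨M, c, hc, he⟩ := exists_initialPart_eq_monomial hS
  exact h ⟨M, c, hc, he ▸ Ideal.subset_span ⟨P, hP, rfl⟩⟩

/-- A polynomial whose reduction modulo `t` is `x^M` plus terms that involve some `x_{ij}` with
`j ∉ S_i`, where `x^M` involves only `x_{ij}` with `j ∈ S_i`, attains the minimum `0` of its
tropicalisation at `M` only. -/
theorem not_isTropSolution_of_map_eq {S : Fin n → Set ℕ} {P : DiffPoly n K⟦X⟧} {M : Expo n}
    (hM : ∀ p ∈ M.support, p.2 ∈ S p.1) {Q : DiffPoly n K}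
    (hQ : Q ∈ Ideal.span (MvPolynomial.X '' {p : Fin n × ℕ | p.2 ∉ S p.1}))
    (hP : MvPolynomial.map (constantCoeff (R := K)) P + Q = MvPolynomial.monomial M 1) :
    ¬ IsTropSolution (tropPoly P) S := by
  classical
  rw [MvPolynomial.mem_ideal_span_X_image] at hQ
  have hcoeff : ∀ N, constantCoeff (P.coeff N) + Q.coeff N = if M = N then 1 else 0 := by
    intro N
    rw [← MvPolynomial.coeff_map, ← MvPolynomial.coeff_add, hP, MvPolynomial.coeff_monomial]
  have hval : ∀ N, termValue (tropPoly P) S N = 0 ↔ N = M := by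
    intro N
    have hw : weight S N = 0 ↔ ∀ p ∈ N.support, p.2 ∈ S p.1 := by
      rw [weight, Finsupp.sum, Finset.sum_eq_zero_iff]
      refine forall₂_congr fun p hp => ?_
      rw [← Val_eq_zero_iff, nsmul_eq_mul, mul_eq_zero]
      simp [Finsupp.mem_support_iff.1 hp]
    rw [termValue, coeff_tropPoly, Tropical.untrop_trop, add_eq_zero, hw,
      ← not_ne_iff, PowerSeries.order_ne_zero_iff_constCoeff_eq_zero]
    have hQN : (∀ p ∈ N.support, p.2 ∈ S p.1) → Q.coeff N = 0 := by
      intro hN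
      by_contra hne
      obtain ⟨p, hp, hpN⟩ := hQ N (MvPolynomial.mem_support_iff.2 hne)
      exact hp (hN p (Finsupp.mem_support_iff.2 hpN))
    constructor
    · rintro ⟨h1, h2⟩
      have := hcoeff N
      rw [hQN h2, add_zero] at this
      by_contra hne
      rw [if_neg (Ne.symm hne)] at this
      exact h1 this
    · rintro rfl
      refine ⟨?_, hM⟩
      have := hcoeff N
      rw [hQN hM, add_zero, if_pos rfl] at this
      rw [this]
      exact one_ne_zero
  have hMs : M ∈ (tropPoly P).support := by
    rw [mem_support_tropPoly, MvPolynomial.mem_support_iff]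
    intro h0
    have := (hval M).2 rfl
    rw [termValue, coeff_tropPoly, h0] at this
    simp at this
  have h0 : tropEval (tropPoly P) S = 0 :=
    le_antisymm ((Finset.inf_le hMs).trans ((hval M).2 rfl).le) bot_le
  rw [IsTropSolution, h0]
  rintro (⟨M₁, -, M₂, -, hne, h1, h2⟩ | h)
  · exact hne (((hval M₁).1 h1.symm).trans ((hval M₂).1 h2.symm).symm)
  · exact ENat.zero_ne_top h

variable [CharZero K]

/-! ### Solutions and tropical solutions -/

/-- The leading coefficients of the derivatives of a solution form a zero of the initial ideal
all of whose coordinates are nonzero. -/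
theorem not_containsMonomial_of_mem_Sol {I : Ideal (DiffPoly n K⟦X⟧)} {φ : Fin n → K⟦X⟧}
    (hφ : φ ∈ Sol (ddt K) (I : Set (DiffPoly n K⟦X⟧))) :
    ¬ ContainsMonomial (initialIdeal (tropTuple φ) I) := by
  choose u hu hu0 using fun p : Fin n × ℕ => exists_iterate_ddt_eq (φ p.1) p.2
  have hle : initialIdeal (tropTuple φ) I ≤
      RingHom.ker (MvPolynomial.eval fun p => constantCoeff (u p)) := by
    refine Ideal.span_le.2 ?_
    rintro _ ⟨P, hP, rfl⟩
    change MvPolynomial.eval _ _ = 0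
    rw [initialPart, ← constantCoeff_eval]
    by_cases htop : tropEval (tropPoly P) (tropTuple φ) = ⊤
    · simp [normalised, htop]
    · have h1 : MvPolynomial.eval u (rescale (tropTuple φ) P) = 0 := by
        rw [eval_rescale]
        refine Eq.trans ?_ (hφ P hP)
        rw [evalAt]
        congr 2
        funext p
        exact (hu p).symm
      rw [← C_mul_normalised _ _ htop, map_mul, MvPolynomial.eval_C, tPow, if_neg htop] at h1
      rw [(mul_eq_zero.1 h1).resolve_left (pow_ne_zero _ PowerSeries.X_ne_zero), map_zero]
  rintro ⟨M, c, hc, hM⟩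
  have h0 : MvPolynomial.eval (fun p => constantCoeff (u p)) (MvPolynomial.monomial M c) = 0 :=
    hle hM
  rw [MvPolynomial.eval_monomial] at h0
  exact mul_ne_zero hc (Finset.prod_ne_zero_iff.2 fun p _ => pow_ne_zero _ (hu0 p)) h0

theorem exists_mem_Sol_of_mem_TropSol [IsAlgClosed K] [Uncountable K]
    {I : Ideal (DiffPoly n K⟦X⟧)} (hI : IsDifferentialIdeal (ddt K) I) {S : Fin n → Set ℕ}
    (hS : S ∈ TropSol (tropPoly '' (I : Set (DiffPoly n K⟦X⟧)))) :
    ∃ φ ∈ Sol (ddt K) (I : Set (DiffPoly n K⟦X⟧)), tropTuple φ = S := by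
  let r : DiffPoly n K⟦X⟧ →+* DiffPoly n K := MvPolynomial.map (constantCoeff (R := K))
  have hr : Function.Surjective r := MvPolynomial.map_surjective _ PowerSeries.constantCoeff_surj
  let V : Ideal (DiffPoly n K) :=
    Ideal.span (MvPolynomial.X '' {p : Fin n × ℕ | p.2 ∉ S p.1})
  obtain ⟨a, ha, ha0⟩ := MvPolynomial.exists_zero_ne_zero_on (I.map r ⊔ V)
    {p : Fin n × ℕ | p.2 ∈ S p.1} (by
      intro M hM hmem
      obtain ⟨P', hP', Q, hQ, he⟩ := Submodule.mem_sup.1 hmem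
      obtain ⟨P, hP, rfl⟩ := (Ideal.mem_map_iff_of_surjective r hr).1 hP'
      exact not_isTropSolution_of_map_eq (fun p hp => hM hp) hQ he (hS _ ⟨P, hP, rfl⟩))
  obtain ⟨φ, hφ⟩ := exists_constantCoeff_iterate_ddt a
  refine ⟨φ, (mem_Sol_iff hI φ).2 fun P hP => ?_, ?_⟩
  · rw [show (fun p : Fin n × ℕ => constantCoeff ((ddt K)^[p.2] (φ p.1))) = a from funext hφ]
    exact ha _ (Ideal.mem_sup_left (Ideal.mem_map_of_mem r hP))
  · funext i
    ext j
    have h1 := coeff_iterate_ddt_ne_zero (ψ := φ i) (j := j) (m := 0)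
    rw [PowerSeries.coeff_zero_eq_constantCoeff_apply, hφ (i, j), zero_add] at h1
    rw [tropTuple, ← h1]
    constructor
    · intro h
      by_contra hj
      refine h ?_
      have := ha (MvPolynomial.X (i, j))
        (Ideal.mem_sup_right (Ideal.subset_span ⟨(i, j), hj, rfl⟩))
      rwa [MvPolynomial.eval_X] at this
    · exact fun h => ha0 (i, j) h

end InitialParts

end TropDiff

theorem theorem3p7 {K : Type*} [Field K] [IsAlgClosed K] [CharZero K] [Uncountable K]
    (n : ℕ) (I : Ideal (TropDiff.DiffPoly n (PowerSeries K)))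
    (hI : TropDiff.IsDifferentialIdeal (TropDiff.ddt K) I) :
    TropDiff.tropTuple '' TropDiff.Sol (TropDiff.ddt K) (I : Set (TropDiff.DiffPoly n (PowerSeries K)))
        = TropDiff.TropSol (TropDiff.tropPoly '' (I : Set (TropDiff.DiffPoly n (PowerSeries K)))) ∧
    TropDiff.TropSol (TropDiff.tropPoly '' (I : Set (TropDiff.DiffPoly n (PowerSeries K))))
        = {S : Fin n → Set ℕ | ¬ TropDiff.ContainsMonomial (TropDiff.initialIdeal S I)} := by
  constructor
  · refine Set.Subset.antisymm ?_ fun S hS => TropDiff.exists_mem_Sol_of_mem_TropSol hI hS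
    rintro _ ⟨φ, hφ, rfl⟩
    exact TropDiff.mem_TropSol_of_not_containsMonomial
      (TropDiff.not_containsMonomial_of_mem_Sol hφ)
  · refine Set.Subset.antisymm (fun S hS => ?_)
      fun S hS => TropDiff.mem_TropSol_of_not_containsMonomial hS
    obtain ⟨φ, hφ, rfl⟩ := TropDiff.exists_mem_Sol_of_mem_TropSol hI hS
    exact TropDiff.not_containsMonomial_of_mem_Sol hφ
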